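/- Let $\mathcal J=\begin{pmatrix}0&-1&0\\1&0&0\\0&0&0\end{pmatrix}$. For real $\sigma_1>1$ and real $\sigma_2$ put $\eta_{kl}=1$ if $k\sigma_2-l\ge 0$ and $\eta_{kl}=-1$ if $k\sigma_2-l<0$, and define the Moser–Siegel model by $$\mathcal A(\theta,\phi)=\mathcal A_{21}(\theta,\phi)\,\mathcal J,\qquad \mathcal A_{21}(\theta,\phi)=\sum_{k,l=1}^\infty \sigma_1^{-k-l}\,\eta_{kl}\,\sin(k\phi-l\theta).$$ For $\omega\in\mathbb R$ let $f(\theta)=\mathcal A_{21}(\theta,\omega\theta)$ and $g(\theta)=\int_0^\theta (f(\theta')-\bar f)\,d\theta'$, where $\bar f=\lim_{T\to\infty}\frac1T\int_0^T f(\theta)\,d\theta$, and let the spin transport matrix $\Phi(\cdot;0)$ be the $3\times3$ matrix function with $\frac{d}{d\theta}\Phi(\theta;0)=\mathcal A(\theta,\omega\theta)\,\Phi(\theta;0)$ and $\Phi(0;0)=I$. If $\omega$ is irrational, the limit $\bar f$ exists, and $\Phi(\cdot;0)$ exists and is unique. A function $h:\mathbb R\to\mathbb R$ is called quasiperiodic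 with tune vector $\nu\in\mathbb R^n$ if $h(\theta)=F(\nu\theta)$ for all $\theta$, for some continuous $F:\mathbb R^n\to\mathbb R$ that is $2\pi$-periodic in each variable; a complex-valued (matrix-valued) function is quasiperiodic if, for some $n$ and some $\nu\in\mathbb R^n$, its real and imaginary parts (its components) are all quasiperiodic with tune vector $\nu$. **Proposition.** There exist an irrational $\omega$ and real $\sigma_1>1$, $\sigma_2$ such that $g$ is unbounded on $\mathbb R$. For all irrational $\omega$ and all real $\sigma_1>1$, $\sigma_2$ for which $g$ is unbounded, $\exp(ig)$ is not quasiperiodic, and $\Phi(\cdot;0)$ is not quasiperiodic. -/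

import Mathlib

open Filter Topology

noncomputable section

namespace SpinOrbit

/-- `f : ℝ → ℝ` is quasiperiodic with tune vector `ν ∈ ℝᵏ`: `f θ = F (ν θ)` for a continuous
`F : ℝᵏ → ℝ` which is `2π`-periodic in each of its `k` variables. -/
def RealQuasiperiodicWith {k : ℕ} (ν : Fin k → ℝ) (f : ℝ → ℝ) : Prop :=
  ∃ F : (Fin k → ℝ) → ℝ, Continuous F ∧
    (∀ i : Fin k, Function.Periodic F (Pi.single i (2 * Real.pi))) ∧
    ∀ θ : ℝ, f θ = F (θ • ν)

/-- A complex function is quasiperiodic with tune vector `ν` if its real and imaginary parts are. -/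
def ComplexQuasiperiodicWith {k : ℕ} (ν : Fin k → ℝ) (f : ℝ → ℂ) : Prop :=
  RealQuasiperiodicWith ν (fun θ => (f θ).re) ∧ RealQuasiperiodicWith ν (fun θ => (f θ).im)

/-- A real matrix valued function is quasiperiodic with tune vector `ν` if its components are. -/
def MatrixQuasiperiodicWith {k : ℕ} (ν : Fin k → ℝ) {m n : Type*} (f : ℝ → Matrix m n ℝ) : Prop :=
  ∀ i j, RealQuasiperiodicWith ν (fun θ => f θ i j)

/-- A complex function is quasiperiodic if it is so for some tune vector of some finite order. -/
def ComplexQuasiperiodic (f : ℝ → ℂ) : Prop :=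
  ∃ (k : ℕ) (ν : Fin k → ℝ), ComplexQuasiperiodicWith ν f

/-- A real matrix valued function is quasiperiodic if it is so for some tune vector of some
finite order. -/
def MatrixQuasiperiodic {m n : Type*} (f : ℝ → Matrix m n ℝ) : Prop :=
  ∃ (k : ℕ) (ν : Fin k → ℝ), MatrixQuasiperiodicWith ν f

/-- The mean of `f` exists and equals `a`: `(1/T) ∫₀ᵀ f → a` as `T → ∞`. -/
def HasMean (f : ℝ → ℝ) (a : ℝ) : Prop :=
  Tendsto (fun T : ℝ => (1 / T) * ∫ θ in (0 : ℝ)..T, f θ) atTop (𝓝 a)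

/-- The mean of `f` (meaningful when some `a` satisfies `HasMean f a`). -/
def mean (f : ℝ → ℝ) : ℝ :=
  limUnder atTop (fun T : ℝ => (1 / T) * ∫ θ in (0 : ℝ)..T, f θ)

/-- The zero-mean part of `f`. -/
def zeroMeanPart (f : ℝ → ℝ) (θ : ℝ) : ℝ := f θ - mean f

/-- For one orbital angle (`d = 1`) and `𝒜 = 𝒜(θ, φ)`, the matrix
`A(θ; φ₀, ω) = 𝒜(θ, ω θ + φ₀)` along the orbit with phase `φ₀` and orbital tune `ω`. -/
def alongOrbit (𝒜 : ℝ → ℝ → Matrix (Fin 3) (Fin 3) ℝ) (ω φ₀ θ : ℝ) : Matrix (Fin 3) (Fin 3) ℝ :=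
  𝒜 θ (ω * θ + φ₀)

/-- `Φ` is the principal solution matrix (spin transport matrix from azimuth `0` to `θ`):
`dΦ/dθ = A(θ) Φ`, `Φ(0) = I`, the derivative being taken entrywise. -/
def IsPrincipalSolutionMatrix (A Φ : ℝ → Matrix (Fin 3) (Fin 3) ℝ) : Prop :=
  (∀ θ : ℝ, ∀ i j, HasDerivAt (fun t => Φ t i j) ((A θ * Φ θ) i j) θ) ∧ Φ 0 = 1

/-- The generator `𝒥` of rotations about the third axis. -/
def genJ : Matrix (Fin 3) (Fin 3) ℝ := !![0, -1, 0; 1, 0, 0; 0, 0, 0]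

namespace MoserSiegel

/-- The sign `η_{kl}`. -/
def eta (σ₂ : ℝ) (k l : ℕ+) : ℝ := if 0 ≤ (k : ℝ) * σ₂ - (l : ℝ) then 1 else -1

/-- `𝒜₂₁(θ, φ) = ∑_{k,l ≥ 1} σ₁^{-k-l} η_{kl} sin(k φ - l θ)`. -/
def A21 (σ₁ σ₂ θ φ : ℝ) : ℝ :=
  ∑' p : ℕ+ × ℕ+, σ₁ ^ (-(p.1 : ℤ) - (p.2 : ℤ)) * eta σ₂ p.1 p.2 *
    Real.sin ((p.1 : ℝ) * φ - (p.2 : ℝ) * θ)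

/-- For `σ₁ > 1` the double series defining `A21` converges absolutely. -/
theorem summable_A21 {σ₁ : ℝ} (h : 1 < σ₁) (σ₂ θ φ : ℝ) :
    Summable (fun p : ℕ+ × ℕ+ => σ₁ ^ (-(p.1 : ℤ) - (p.2 : ℤ)) * eta σ₂ p.1 p.2 *
      Real.sin ((p.1 : ℝ) * φ - (p.2 : ℝ) * θ)) := by
  have h0 : 0 < σ₁ := by linarith
  have hs : Summable (fun k : ℕ+ => (σ₁⁻¹) ^ (k : ℕ)) :=
    (summable_geometric_of_lt_one (inv_nonneg.2 h0.le) (inv_lt_one_of_one_lt₀ h)).comp_injective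
      PNat.coe_injective
  refine Summable.of_norm_bounded (hs.mul_of_nonneg hs (fun k => by positivity)
    (fun k => by positivity)) (fun p => ?_)
  have he : |eta σ₂ p.1 p.2| = 1 := by unfold eta; split_ifs <;> simp
  have hp : σ₁ ^ (-(p.1 : ℤ) - (p.2 : ℤ)) = (σ₁⁻¹) ^ (p.1 : ℕ) * (σ₁⁻¹) ^ (p.2 : ℕ) := by
    rw [zpow_sub₀ h0.ne', zpow_neg, div_eq_mul_inv, inv_pow, inv_pow]
    norm_cast
  rw [hp, Real.norm_eq_abs, abs_mul, abs_mul, he, mul_one, abs_of_nonneg (by positivity)]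
  exact mul_le_of_le_one_right (by positivity) (Real.abs_sin_le_one _)

/-- The matrix `𝒜 = 𝒜₂₁ 𝒥` of the Moser–Siegel model. -/
def spinMatrix (σ₁ σ₂ θ φ : ℝ) : Matrix (Fin 3) (Fin 3) ℝ := A21 σ₁ σ₂ θ φ • genJ

/-- `f(θ) = 𝒜₂₁(θ, ω θ) = ∑_{k,l ≥ 1} σ₁^{-k-l} η_{kl} sin((k ω - l) θ)`, so that
`A(θ; 0, ω) = f(θ) 𝒥`. -/
def f (σ₁ σ₂ ω θ : ℝ) : ℝ := A21 σ₁ σ₂ θ (ω * θ)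

/-- `g(θ) = ∫₀^θ f̃`, where `f̃` is the zero-mean part of `f`. -/
def g (σ₁ σ₂ ω θ : ℝ) : ℝ := ∫ t in (0 : ℝ)..θ, zeroMeanPart (f σ₁ σ₂ ω) t

end MoserSiegel

end SpinOrbit

end

/-!
Writing `f(θ) = ∑ aₚ sin(xₚ θ)` with `xₚ = kω - l ≠ 0` and `∑ |aₚ| < ∞`, termwise integration
gives `∫₀^θ f = ∑ aₚ (1 - cos(xₚ θ)) / xₚ` (`hasSum_integral_f`). Each summand divided by `θ` is
bounded by `|aₚ|` and tends to `0`, so `f` has mean zero, `g = ∫₀ f` and `g(T) = o(T)`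
(`hasMean_f`, `g_eq_integral`). Since all the matrices `A(θ)` are multiples of `𝒥`, the spin
transport matrix is the rotation by the angle `g(θ)` about the third axis
(`isPrincipalSolutionMatrix_iff`).

*Unboundedness occurs.* For `σ₂ = ω` the signs `η_{kl}` make every summand of the series for `g`
nonnegative, so at `θ = π / (kω - l)` the function `g` is at least the single summand
`2 σ₁^{-k-l} / |kω - l|`. By Baire's theorem there is an irrational `ω` for which these numbers
are unbounded (`exists_irrational_approx`).

*Unboundedness prevents quasiperiodicity.* This is a case of Bohr's theorem on the argument of an
almost periodic function (`bounded_of_exp_quasiperiodic`). If `exp(ig)` is quasiperiodic, then up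
to a small uniform error it has only finitely many translates, because the orbit of a linear flow
on a torus is totally bounded (`exists_finite_translates`). When the translates by `t` and by `s`
are close, `g(u + t) - g(u + s)` stays within `π / 2` of some `2πn`, with `n` independent of `u`
by continuity. As `g(T) = o(T)`, iterating the shift by `t - s` forces `n = 0`
(`abs_le_of_shift_approx`). So each `g(t)` is within `π / 2` of one of finitely many values.
The entries of `Φ` contain the real and imaginary parts of `exp(ig)`, which settles `Φ` as well.
-/

open Filter Topology

namespace SpinOrbit

/-! ### Finitely many translates of a quasiperiodic function -/

theorem periodic_intCast_smul {k : ℕ} {E : Type*} {F : (Fin k → ℝ) → E} {c : ℝ}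
    (hF : ∀ i : Fin k, Function.Periodic F (Pi.single i c)) (z : Fin k → ℤ) :
    Function.Periodic F (fun i => (z i : ℝ) * c) := by
  have key : ∀ s : Finset (Fin k),
      Function.Periodic F (∑ i ∈ s, z i • (Pi.single i c : Fin k → ℝ)) := by
    intro s
    induction s using Finset.induction_on with
    | empty => intro x; simp
    | insert i s hi ih =>
      rw [Finset.sum_insert hi]
      exact ((hF i).zsmul (z i)).add_period ih
  have h := key Finset.univ
  have e : (∑ i, z i • (Pi.single i c : Fin k → ℝ)) = fun i => (z i : ℝ) * c := by
    ext j
    simp [Finset.sum_apply, Pi.single_apply]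
  rwa [e] at h

/-- Up to a uniform error `ε`, a quasiperiodic function has only finitely many translates. -/
theorem exists_finite_translates {k : ℕ} {E : Type*} [SeminormedAddCommGroup E]
    {F : (Fin k → ℝ) → E} (hc : Continuous F)
    (hF : ∀ i : Fin k, Function.Periodic F (Pi.single i (2 * Real.pi)))
    (ν : Fin k → ℝ) {ε : ℝ} (hε : 0 < ε) :
    ∃ S : Set ℝ, S.Finite ∧ ∀ t : ℝ, ∃ s ∈ S, ∀ u : ℝ,
      ‖F ((u + t) • ν) - F ((u + s) • ν)‖ < ε := by
  have h2π : 0 < 2 * Real.pi := Real.two_pi_pos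
  -- `r t` is the representative of `t • ν` in the fundamental cube of the torus.
  let r : ℝ → Fin k → ℝ := fun t i => Int.fract (t * ν i / (2 * Real.pi)) * (2 * Real.pi)
  have hr0 : ∀ t i, 0 ≤ r t i := fun t i => mul_nonneg (Int.fract_nonneg _) h2π.le
  have hr1 : ∀ t i, r t i ≤ 2 * Real.pi := fun t i =>
    mul_le_of_le_one_left h2π.le (Int.fract_lt_one _).le
  have hrF : ∀ t x, F (x + t • ν) = F (x + r t) := by
    intro t x
    have e : x + t • ν =
        x + r t + fun i => ((⌊t * ν i / (2 * Real.pi)⌋ : ℤ) : ℝ) * (2 * Real.pi) := by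
      ext i
      simp only [r, Pi.add_apply, Pi.smul_apply, smul_eq_mul, Int.fract]
      field_simp
      ring
    rw [e]
    exact periodic_intCast_smul hF _ _
  have hrr : ∀ u t, F ((u + t) • ν) = F (r u + r t) := by
    intro u t
    rw [add_smul, hrF, add_comm, hrF, add_comm]
  let K : Set (Fin k → ℝ) := Set.Icc 0 (fun _ => 2 * (2 * Real.pi))
  have hK : ∀ u t, r u + r t ∈ K := fun u t =>
    ⟨fun i => add_nonneg (hr0 u i) (hr0 t i), fun i => by
      have := hr1 u i
      have := hr1 t i
      simp only [Pi.add_apply]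
      linarith⟩
  have huc : UniformContinuousOn F K :=
    isCompact_Icc.uniformContinuousOn_of_continuous hc.continuousOn
  obtain ⟨δ, hδ, hd⟩ := Metric.uniformContinuousOn_iff.1 huc ε hε
  have htb : TotallyBounded (Set.range r) := by
    refine (isCompact_Icc (a := (0 : Fin k → ℝ))
      (b := fun _ => 2 * Real.pi)).totallyBounded.subset ?_
    rintro _ ⟨t, rfl⟩
    exact ⟨hr0 t, hr1 t⟩
  obtain ⟨N, hNr, hNf, hN⟩ := Metric.finite_approx_of_totallyBounded htb δ hδ
  refine ⟨Function.invFun r '' N, hNf.image _, fun t => ?_⟩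
  obtain ⟨y, hy, hty⟩ := Set.mem_iUnion₂.1 (hN ⟨t, rfl⟩)
  refine ⟨_, ⟨y, hy, rfl⟩, fun u => ?_⟩
  have hry : r (Function.invFun r y) = y := Function.invFun_eq (hNr hy)
  rw [hrr, hrr, ← dist_eq_norm]
  refine hd _ (hK _ _) _ (hK _ _) ?_
  rw [hry, dist_add_left]
  exact hty

/-! ### The argument of a quasiperiodic function -/

/-- A function with `g(T) = o(T)` cannot increase by approximately `c` under a fixed shift, unless
`c` is within the error of the approximation. -/
theorem abs_le_of_shift_approx {g : ℝ → ℝ}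
    (hlim : Tendsto (fun T => 1 / T * g T) atTop (𝓝 0)) {τ c B : ℝ}
    (h : ∀ v, |g (v + τ) - g v - c| ≤ B) : |c| ≤ B := by
  have pos : ∀ τ c : ℝ, 0 < τ → (∀ v, |g (v + τ) - g v - c| ≤ B) → |c| ≤ B := by
    intro τ c hτ h
    have iter : ∀ m : ℕ, |g (m * τ) - g 0 - m * c| ≤ m * B := by
      intro m
      induction m with
      | zero => simp
      | succ m ih =>
        have h1 := h (m * τ)
        have e : ((m + 1 : ℕ) : ℝ) * τ = m * τ + τ := by push_cast; ring
        rw [e]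
        push_cast
        rw [abs_le] at *
        constructor <;> linarith [h1.1, h1.2, ih.1, ih.2]
    have hm : Tendsto (fun m : ℕ => (m : ℝ) * τ) atTop atTop :=
      tendsto_natCast_atTop_atTop.atTop_mul_const hτ
    have l1 : Tendsto (fun m : ℕ => τ * (1 / ((m : ℝ) * τ) * g (m * τ)) - g 0 * (m : ℝ)⁻¹ - c)
        atTop (𝓝 (τ * 0 - g 0 * 0 - c)) :=
      (((hlim.comp hm).const_mul τ).sub
        (tendsto_inv_atTop_nhds_zero_nat.const_mul (g 0))).sub_const c
    have l2 := l1.abs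
    have e : |τ * 0 - g 0 * 0 - c| = |c| := by simp
    rw [e] at l2
    refine le_of_tendsto l2 ?_
    filter_upwards [eventually_gt_atTop 0] with m hm0
    have hm' : (0 : ℝ) < m := by exact_mod_cast hm0
    have e : τ * (1 / ((m : ℝ) * τ) * g (m * τ)) - g 0 * (m : ℝ)⁻¹ - c
        = (g (m * τ) - g 0 - m * c) / m := by
      field_simp
    rw [e, abs_div, abs_of_pos hm', div_le_iff₀ hm', mul_comm B]
    exact iter m
  rcases lt_trichotomy τ 0 with hτ | rfl | hτ
  · rw [← abs_neg]
    refine pos (-τ) (-c) (by linarith) fun v => ?_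
    have := h (v + -τ)
    rw [neg_add_cancel_right, ← abs_neg] at this
    convert this using 2
    ring
  · simpa using h 0
  · exact pos τ c hτ h

/-- A continuous real function whose cosine is positive stays in one component of `{cos > 0}`. -/
theorem exists_int_abs_sub_lt {D : ℝ → ℝ} (hD : Continuous D) (hcos : ∀ u, 0 < Real.cos (D u)) :
    ∃ n : ℤ, ∀ u, |D u - 2 * Real.pi * n| < Real.pi / 2 := by
  have hπ := Real.pi_pos
  refine ⟨round (D 0 / (2 * Real.pi)), ?_⟩
  set n := round (D 0 / (2 * Real.pi)) with hn
  have hE : ∀ u, 0 < Real.cos |D u - 2 * Real.pi * n| := by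
    intro u
    rw [Real.cos_abs, mul_comm, Real.cos_sub_int_mul_two_pi]
    exact hcos u
  have h0 : |D 0 - 2 * Real.pi * n| < Real.pi / 2 := by
    by_contra! hge
    refine absurd (hE 0) (not_lt.2 (Real.cos_nonpos_of_pi_div_two_le_of_le hge ?_))
    have h1 := abs_sub_round (D 0 / (2 * Real.pi))
    have e : D 0 - 2 * Real.pi * n = (D 0 / (2 * Real.pi) - n) * (2 * Real.pi) := by
      field_simp
    rw [e, abs_mul, abs_of_pos Real.two_pi_pos]
    rw [← hn] at h1
    nlinarith
  intro u
  by_contra! hge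
  obtain ⟨v, hv⟩ := mem_range_of_exists_le_of_exists_ge
    (f := fun u => |D u - 2 * Real.pi * n|) (by fun_prop) ⟨0, h0.le⟩ ⟨u, hge⟩
  have := hE v
  simp only at hv
  rw [hv, Real.cos_pi_div_two] at this
  exact lt_irrefl _ this

/-- A case of Bohr's theorem on the argument of an almost periodic function: if `g` is continuous
with `g(T) = o(T)` and `exp(ig)` is quasiperiodic, then `g` is bounded. -/
theorem bounded_of_exp_quasiperiodic {g : ℝ → ℝ} (hg : Continuous g)
    (hlim : Tendsto (fun T => 1 / T * g T) atTop (𝓝 0))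
    (hq : ComplexQuasiperiodic (fun θ => Complex.exp (Complex.I * (g θ : ℂ)))) :
    ∃ C : ℝ, ∀ θ : ℝ, |g θ| ≤ C := by
  obtain ⟨k, ν, ⟨F₁, hc₁, hp₁, h₁⟩, ⟨F₂, hc₂, hp₂, h₂⟩⟩ := hq
  have hFg : ∀ θ, ((F₁ (θ • ν) : ℂ) + F₂ (θ • ν) * Complex.I)
      = Complex.exp (Complex.I * (g θ : ℂ)) := by
    intro θ
    rw [← h₁, ← h₂]
    exact Complex.re_add_im _
  obtain ⟨S, hS, hSt⟩ := exists_finite_translates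
    (F := fun x => (F₁ x : ℂ) + F₂ x * Complex.I) (by fun_prop)
    (fun i x => by simp only [hp₁ i x, hp₂ i x]) ν (ε := 1) one_pos
  obtain ⟨M, hM⟩ := (hS.image fun s => |g s|).bddAbove
  refine ⟨M + Real.pi / 2, fun t => ?_⟩
  obtain ⟨s, hs, hts⟩ := hSt t
  have hcos : ∀ u, 0 < Real.cos (g (u + t) - g (u + s)) := by
    intro u
    have h := hts u
    simp only [hFg] at h
    -- `‖e^{ia} - e^{ib}‖² = 2 - 2 cos (a - b)`
    have hsq := Complex.sq_norm (Complex.exp (Complex.I * (g (u + t) : ℂ))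
      - Complex.exp (Complex.I * (g (u + s) : ℂ)))
    rw [mul_comm Complex.I, mul_comm Complex.I] at h hsq
    rw [Complex.normSq_apply, Complex.sub_re, Complex.sub_im, Complex.exp_ofReal_mul_I_re,
      Complex.exp_ofReal_mul_I_im, Complex.exp_ofReal_mul_I_re,
      Complex.exp_ofReal_mul_I_im] at hsq
    rw [Real.cos_sub]
    have h0 := norm_nonneg (Complex.exp ((g (u + t) : ℂ) * Complex.I)
      - Complex.exp ((g (u + s) : ℂ) * Complex.I))
    nlinarith [Real.sin_sq_add_cos_sq (g (u + t)), Real.sin_sq_add_cos_sq (g (u + s))]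
  obtain ⟨n, hn⟩ := exists_int_abs_sub_lt
    (D := fun u => g (u + t) - g (u + s)) (by fun_prop) hcos
  have hsmall : |2 * Real.pi * (n : ℝ)| ≤ Real.pi / 2 := by
    refine abs_le_of_shift_approx hlim (τ := t - s) fun v => ?_
    have := (hn (v - s)).le
    simp only [sub_add_cancel] at this
    rwa [show v - s + t = v + (t - s) by ring] at this
  have hn0 : n = 0 := by
    rw [abs_mul, abs_of_pos Real.two_pi_pos] at hsmall
    have h1 : |(n : ℝ)| < 1 := by
      have := Real.pi_pos
      by_contra! hge
      nlinarith
    exact Int.abs_lt_one_iff.1 (by exact_mod_cast h1)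
  have h0 := hn 0
  simp only [hn0, Int.cast_zero, mul_zero, sub_zero, zero_add] at h0
  have hMs : |g s| ≤ M := hM ⟨s, hs, rfl⟩
  have := abs_sub_abs_le_abs_sub (g t) (g s)
  linarith

namespace MoserSiegel

/-! ### The function `f` and its integral -/

/-- The coefficient `σ₁^{-k-l} η_{kl}` of the Moser–Siegel series. -/
noncomputable def coeff (σ₁ σ₂ : ℝ) (p : ℕ+ × ℕ+) : ℝ :=
  σ₁ ^ (-(p.1 : ℤ) - (p.2 : ℤ)) * eta σ₂ p.1 p.2

/-- The frequency `kω - l` of the Moser–Siegel series along an orbit of tune `ω`. -/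
def freq (ω : ℝ) (p : ℕ+ × ℕ+) : ℝ := (p.1 : ℝ) * ω - (p.2 : ℝ)

theorem f_eq_tsum (σ₁ σ₂ ω θ : ℝ) :
    f σ₁ σ₂ ω θ = ∑' p, coeff σ₁ σ₂ p * Real.sin (freq ω p * θ) := by
  unfold f A21 coeff freq
  refine tsum_congr fun p => ?_
  congr 2
  ring

theorem abs_coeff {σ₁ : ℝ} (h : 1 < σ₁) (σ₂ : ℝ) (p : ℕ+ × ℕ+) :
    |coeff σ₁ σ₂ p| = σ₁ ^ (-(p.1 : ℤ) - (p.2 : ℤ)) := by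
  have he : |eta σ₂ p.1 p.2| = 1 := by unfold eta; split_ifs <;> simp
  have h0 : 0 < σ₁ := by linarith
  rw [coeff, abs_mul, he, mul_one, abs_of_pos (zpow_pos h0 _)]

theorem summable_abs_coeff {σ₁ : ℝ} (h : 1 < σ₁) (σ₂ : ℝ) :
    Summable fun p => |coeff σ₁ σ₂ p| := by
  have h0 : 0 < σ₁ := by linarith
  have hs : Summable (fun k : ℕ+ => (σ₁⁻¹) ^ (k : ℕ)) :=
    (summable_geometric_of_lt_one (inv_nonneg.2 h0.le) (inv_lt_one_of_one_lt₀ h)).comp_injective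
      PNat.coe_injective
  refine (hs.mul_of_nonneg hs (fun k => by positivity) (fun k => by positivity)).congr fun p => ?_
  rw [abs_coeff h, zpow_sub₀ h0.ne', zpow_neg, div_eq_mul_inv, inv_pow, inv_pow]
  norm_cast

theorem freq_ne_zero {ω : ℝ} (hω : Irrational ω) (p : ℕ+ × ℕ+) : freq ω p ≠ 0 := by
  have h := (hω.natCast_mul p.1.ne_zero).ne_nat (p.2 : ℕ)
  exact sub_ne_zero.2 h

theorem abs_coeff_mul_sin_le (σ₁ σ₂ ω θ : ℝ) (p : ℕ+ × ℕ+) :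
    ‖coeff σ₁ σ₂ p * Real.sin (freq ω p * θ)‖ ≤ |coeff σ₁ σ₂ p| := by
  rw [Real.norm_eq_abs, abs_mul]
  exact mul_le_of_le_one_right (abs_nonneg _) (Real.abs_sin_le_one _)

theorem continuous_f {σ₁ : ℝ} (h : 1 < σ₁) (σ₂ ω : ℝ) : Continuous (f σ₁ σ₂ ω) := by
  have e : f σ₁ σ₂ ω = fun θ => ∑' p, coeff σ₁ σ₂ p * Real.sin (freq ω p * θ) :=
    funext (f_eq_tsum σ₁ σ₂ ω)
  rw [e]
  exact continuous_tsum (fun p => by fun_prop) (summable_abs_coeff h σ₂)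
    fun p θ => abs_coeff_mul_sin_le _ _ _ _ _

theorem integral_sin_freq {x : ℝ} (hx : x ≠ 0) (c θ : ℝ) :
    ∫ t in (0 : ℝ)..θ, c * Real.sin (x * t) = c * (1 - Real.cos (x * θ)) / x := by
  rw [intervalIntegral.integral_const_mul, intervalIntegral.integral_comp_mul_left _ hx,
    integral_sin]
  simp
  ring

theorem hasSum_integral_f {σ₁ ω : ℝ} (h : 1 < σ₁) (hω : Irrational ω) (σ₂ θ : ℝ) :
    HasSum (fun p => coeff σ₁ σ₂ p * (1 - Real.cos (freq ω p * θ)) / freq ω p)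
      (∫ t in (0 : ℝ)..θ, f σ₁ σ₂ ω t) := by
  have key := intervalIntegral.hasSum_integral_of_dominated_convergence
    (μ := MeasureTheory.volume) (a := 0) (b := θ)
    (F := fun p t => coeff σ₁ σ₂ p * Real.sin (freq ω p * t)) (f := f σ₁ σ₂ ω)
    (fun p _ => |coeff σ₁ σ₂ p|)
    (fun p => Continuous.aestronglyMeasurable (by fun_prop))
    (fun p => Eventually.of_forall fun t _ => abs_coeff_mul_sin_le _ _ _ _ _)
    (Eventually.of_forall fun t _ => summable_abs_coeff h σ₂)
    (intervalIntegrable_const)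
    (Eventually.of_forall fun t _ => by
      rw [f_eq_tsum]
      exact (Summable.of_norm_bounded (summable_abs_coeff h σ₂)
        fun p => abs_coeff_mul_sin_le _ _ _ _ _).hasSum)
  exact key.congr_fun fun p => (integral_sin_freq (freq_ne_zero hω p) _ _).symm

theorem hasMean_f {σ₁ ω : ℝ} (h : 1 < σ₁) (hω : Irrational ω) (σ₂ : ℝ) :
    HasMean (f σ₁ σ₂ ω) 0 := by
  have e : ∀ T : ℝ, (1 / T) * ∫ θ in (0 : ℝ)..T, f σ₁ σ₂ ω θ =
      ∑' p, 1 / T * (coeff σ₁ σ₂ p * (1 - Real.cos (freq ω p * T)) / freq ω p) := fun T => by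
    rw [← (hasSum_integral_f h hω σ₂ T).tsum_eq, tsum_mul_left]
  unfold HasMean
  simp_rw [e]
  rw [← tsum_zero (α := ℝ) (β := ℕ+ × ℕ+)]
  refine tendsto_tsum_of_dominated_convergence (summable_abs_coeff h σ₂) (fun p => ?_) ?_
  · have hb : Tendsto (fun T : ℝ => T⁻¹ * (2 * |coeff σ₁ σ₂ p / freq ω p|)) atTop (𝓝 0) := by
      simpa using tendsto_inv_atTop_zero.mul_const (2 * |coeff σ₁ σ₂ p / freq ω p|)
    refine squeeze_zero_norm' ?_ hb
    filter_upwards [eventually_gt_atTop 0] with T hT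
    have h1 : |1 - Real.cos (freq ω p * T)| ≤ 2 := by
      rw [abs_le]
      constructor <;> linarith [Real.cos_le_one (freq ω p * T), Real.neg_one_le_cos (freq ω p * T)]
    rw [mul_div_right_comm, Real.norm_eq_abs, abs_mul, abs_mul, one_div,
      abs_of_pos (inv_pos.2 hT), mul_comm 2]
    gcongr
  · filter_upwards [eventually_gt_atTop 0] with T hT p
    -- The integral of the summand over `[0, T]` is at most `T` times its supremum.
    have h1 := intervalIntegral.norm_integral_le_of_norm_le_const (a := 0) (b := T)
      (f := fun t => coeff σ₁ σ₂ p * Real.sin (freq ω p * t)) (C := |coeff σ₁ σ₂ p|)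
      fun t _ => abs_coeff_mul_sin_le _ _ _ _ _
    rw [integral_sin_freq (freq_ne_zero hω p), sub_zero, abs_of_pos hT] at h1
    rw [norm_mul, norm_div, norm_one, Real.norm_of_nonneg hT.le, one_div, inv_mul_le_iff₀ hT,
      mul_comm T]
    exact h1

theorem mean_f {σ₁ ω : ℝ} (h : 1 < σ₁) (hω : Irrational ω) (σ₂ : ℝ) :
    mean (f σ₁ σ₂ ω) = 0 :=
  (hasMean_f h hω σ₂).limUnder_eq

theorem g_eq_integral {σ₁ ω : ℝ} (h : 1 < σ₁) (hω : Irrational ω) (σ₂ θ : ℝ) :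
    g σ₁ σ₂ ω θ = ∫ t in (0 : ℝ)..θ, f σ₁ σ₂ ω t := by
  simp only [g, zeroMeanPart, mean_f h hω, sub_zero]

theorem hasDerivAt_g {σ₁ ω : ℝ} (h : 1 < σ₁) (hω : Irrational ω) (σ₂ θ : ℝ) :
    HasDerivAt (g σ₁ σ₂ ω) (f σ₁ σ₂ ω θ) θ := by
  rw [funext (g_eq_integral h hω σ₂)]
  exact (continuous_f h σ₂ ω).integral_hasStrictDerivAt 0 θ |>.hasDerivAt

theorem g_zero (σ₁ σ₂ ω : ℝ) : g σ₁ σ₂ ω 0 = 0 := by simp [g]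

theorem continuous_g {σ₁ ω : ℝ} (h : 1 < σ₁) (hω : Irrational ω) (σ₂ : ℝ) :
    Continuous (g σ₁ σ₂ ω) :=
  continuous_iff_continuousAt.2 fun θ => (hasDerivAt_g h hω σ₂ θ).continuousAt

/-! ### Unboundedness for generic tunes -/

/-- A generic positive real number is so well approximable by rationals that the small divisors
`kω - l` beat the exponential decay of the coefficients. -/
theorem exists_irrational_approx : ∃ ω : ℝ, Irrational ω ∧
    ∀ n : ℕ, ∃ p : ℕ+ × ℕ+, |freq ω p| < (2 : ℝ) ^ (-(p.1 : ℤ) - (p.2 : ℤ)) / (n + 1) := by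
  -- The negative half-line is added to make the open set dense in `ℝ`.
  let U : ℕ → Set ℝ := fun n => {ω | ω < 0} ∪
    ⋃ p : ℕ+ × ℕ+, {ω | |freq ω p| < (2 : ℝ) ^ (-(p.1 : ℤ) - (p.2 : ℤ)) / (n + 1)}
  have hUo : ∀ n, IsOpen (U n) := fun n => by
    refine (isOpen_lt continuous_id continuous_const).union (isOpen_iUnion fun p => ?_)
    exact isOpen_lt (by unfold freq; fun_prop) continuous_const
  have hUd : ∀ n, Dense (U n) := fun n => by
    have hd : Dense {x : ℝ | x ≠ 0 ∧ x ∈ Set.range ((↑) : ℚ → ℝ)} :=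
      (Rat.denseRange_cast (𝕜 := ℝ)).sdiff_singleton 0 |>.mono fun x hx => ⟨hx.2, hx.1⟩
    refine hd.mono ?_
    rintro _ ⟨hq0, q, rfl⟩
    rcases lt_or_gt_of_ne hq0 with hq | hq
    · exact Or.inl hq
    · refine Or.inr (Set.mem_iUnion.2 ?_)
      have hq' : 0 < q := by exact_mod_cast hq
      have hnum : 0 < q.num := Rat.num_pos.2 hq'
      refine ⟨(⟨q.den, q.den_pos⟩, ⟨q.num.toNat, by omega⟩), ?_⟩
      have e : freq q (⟨q.den, q.den_pos⟩, ⟨q.num.toNat, by omega⟩) = 0 := by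
        have h1 : ((q.num.toNat : ℕ) : ℝ) = (q.num : ℝ) := by
          exact_mod_cast Int.toNat_of_nonneg hnum.le
        have h2 : (q.den : ℝ) * (q : ℝ) = q.num := by exact_mod_cast Rat.den_mul_eq_num q
        simp only [freq, PNat.mk_coe, h1, h2, sub_self]
      rw [Set.mem_ofPred_eq, e, abs_zero]
      positivity
  have hres : ∀ᶠ ω in residual ℝ, Irrational ω ∧ ∀ n, ω ∈ U n :=
    eventually_residual_irrational.and
      (eventually_countable_forall.2 fun n => residual_of_dense_open (hUo n) (hUd n))
  obtain ⟨ω, ⟨hω, hU⟩, hω0⟩ := (dense_of_mem_residual hres).exists_mem_open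
    (isOpen_Ioi (a := (0 : ℝ))) ⟨1, Set.mem_Ioi.2 one_pos⟩
  refine ⟨ω, hω, fun n => ?_⟩
  rcases hU n with hn | hn
  · exact absurd (Set.mem_Ioi.1 hω0) (not_lt.2 (show ω < 0 from hn).le)
  · exact Set.mem_iUnion.1 hn

/-- With `σ₂ = ω` the sign of the coefficient is that of the frequency. -/
theorem coeff_div_freq {σ₁ : ℝ} (ω : ℝ) (p : ℕ+ × ℕ+) :
    coeff σ₁ ω p / freq ω p = σ₁ ^ (-(p.1 : ℤ) - (p.2 : ℤ)) / |freq ω p| := by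
  unfold coeff eta
  split_ifs with h0
  · rw [mul_one, abs_of_nonneg (show 0 ≤ freq ω p from h0)]
  · rw [abs_of_neg (show freq ω p < 0 from not_le.1 h0), mul_neg_one, div_neg, neg_div]

theorem two_mul_div_abs_freq_le_g {σ₁ ω : ℝ} (h : 1 < σ₁) (hω : Irrational ω) (p : ℕ+ × ℕ+) :
    2 * (σ₁ ^ (-(p.1 : ℤ) - (p.2 : ℤ)) / |freq ω p|) ≤ g σ₁ ω ω (Real.pi / freq ω p) := by
  have h0 : 0 < σ₁ := by linarith
  rw [g_eq_integral h hω]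
  have hs := hasSum_integral_f h hω ω (Real.pi / freq ω p)
  simp only [mul_div_right_comm, coeff_div_freq] at hs
  have hle := le_hasSum hs p fun q _ => mul_nonneg
    (div_nonneg (zpow_pos h0 _).le (abs_nonneg _)) (sub_nonneg.2 (Real.cos_le_one _))
  rw [mul_div_cancel₀ _ (freq_ne_zero hω p), Real.cos_pi] at hle
  linarith

theorem exists_g_unbounded : ∃ ω : ℝ, Irrational ω ∧ ∃ σ₁ σ₂ : ℝ, 1 < σ₁ ∧
    ¬ ∃ C : ℝ, ∀ θ : ℝ, |g σ₁ σ₂ ω θ| ≤ C := by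
  obtain ⟨ω, hω, happ⟩ := exists_irrational_approx
  refine ⟨ω, hω, 2, ω, one_lt_two, fun ⟨C, hC⟩ => ?_⟩
  obtain ⟨n, hn⟩ := exists_nat_gt C
  obtain ⟨p, hp⟩ := happ n
  have h1 := two_mul_div_abs_freq_le_g one_lt_two hω p
  have h2 := (le_abs_self _).trans (hC (Real.pi / freq ω p))
  have hpos : 0 < |freq ω p| := abs_pos.2 (freq_ne_zero hω p)
  have hn1 : (0 : ℝ) < n + 1 := by positivity
  rw [lt_div_iff₀ hn1, mul_comm, ← lt_div_iff₀ hpos] at hp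
  linarith

/-! ### The spin transport matrix -/

/-- The rotation by the angle `x` about the third axis. -/
noncomputable def rotation (x : ℝ) : Matrix (Fin 3) (Fin 3) ℝ :=
  !![Real.cos x, -Real.sin x, 0; Real.sin x, Real.cos x, 0; 0, 0, 1]

theorem alongOrbit_mul_apply (σ₁ σ₂ ω θ : ℝ) (M : Matrix (Fin 3) (Fin 3) ℝ) (j : Fin 3) :
    (alongOrbit (spinMatrix σ₁ σ₂) ω 0 θ * M) 0 j = -(f σ₁ σ₂ ω θ * M 1 j) ∧
    (alongOrbit (spinMatrix σ₁ σ₂) ω 0 θ * M) 1 j = f σ₁ σ₂ ω θ * M 0 j ∧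
    (alongOrbit (spinMatrix σ₁ σ₂) ω 0 θ * M) 2 j = 0 := by
  simp [alongOrbit, spinMatrix, genJ, f, Matrix.mul_apply, Fin.sum_univ_three]

/-- A solution of the planar rotation equation `x' = -a y`, `y' = a x` is the rotation of its
initial value by the angle `G`, where `G' = a` and `G(0) = 0`. -/
theorem eq_rotation_of_hasDerivAt {G a x y : ℝ → ℝ} (hG : ∀ t, HasDerivAt G (a t) t)
    (hG0 : G 0 = 0) (hx : ∀ t, HasDerivAt x (-(a t * y t)) t)
    (hy : ∀ t, HasDerivAt y (a t * x t) t) (t : ℝ) :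
    x t = Real.cos (G t) * x 0 - Real.sin (G t) * y 0 ∧
    y t = Real.sin (G t) * x 0 + Real.cos (G t) * y 0 := by
  have hu : ∀ t, HasDerivAt (fun s => x s * Real.cos (G s) + y s * Real.sin (G s)) 0 t :=
    fun t => (((hx t).mul (hG t).cos).add ((hy t).mul (hG t).sin)).congr_deriv (by ring)
  have hv : ∀ t, HasDerivAt (fun s => y s * Real.cos (G s) - x s * Real.sin (G s)) 0 t :=
    fun t => (((hy t).mul (hG t).cos).sub ((hx t).mul (hG t).sin)).congr_deriv (by ring)
  have cu := is_const_of_deriv_eq_zero (fun t => (hu t).differentiableAt)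
    (fun t => (hu t).deriv) t 0
  have cv := is_const_of_deriv_eq_zero (fun t => (hv t).differentiableAt)
    (fun t => (hv t).deriv) t 0
  simp only [hG0, Real.cos_zero, Real.sin_zero, mul_one, mul_zero, add_zero, sub_zero] at cu cv
  rw [← cu, ← cv]
  constructor
  · linear_combination (-x t) * Real.sin_sq_add_cos_sq (G t)
  · linear_combination (-y t) * Real.sin_sq_add_cos_sq (G t)

theorem isPrincipalSolutionMatrix_iff {σ₁ ω : ℝ} (h : 1 < σ₁) (hω : Irrational ω) (σ₂ : ℝ)
    (Φ : ℝ → Matrix (Fin 3) (Fin 3) ℝ) :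
    IsPrincipalSolutionMatrix (alongOrbit (spinMatrix σ₁ σ₂) ω 0) Φ ↔
      Φ = fun θ => rotation (g σ₁ σ₂ ω θ) := by
  have hg := hasDerivAt_g h hω σ₂
  constructor
  · rintro ⟨hd, h0⟩
    have key := fun j => eq_rotation_of_hasDerivAt hg (g_zero σ₁ σ₂ ω)
      (x := fun t => Φ t 0 j) (y := fun t => Φ t 1 j)
      (fun t => (hd t 0 j).congr_deriv (alongOrbit_mul_apply _ _ _ _ _ j).1)
      (fun t => (hd t 1 j).congr_deriv (alongOrbit_mul_apply _ _ _ _ _ j).2.1)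
    have hz : ∀ j t, Φ t 2 j = Φ 0 2 j := fun j t => is_const_of_deriv_eq_zero
      (f := fun t => Φ t 2 j) (fun t => (hd t 2 j).differentiableAt)
      (fun t => (hd t 2 j).deriv.trans (alongOrbit_mul_apply _ _ _ _ _ j).2.2) t 0
    ext t i j
    fin_cases i
    · have := (key j t).1
      fin_cases j <;> simpa [h0, rotation] using this
    · have := (key j t).2
      fin_cases j <;> simpa [h0, rotation] using this
    · have := hz j t
      fin_cases j <;> simpa [h0, rotation] using this
  · rintro rfl
    refine ⟨fun θ i j => ?_, ?_⟩
    · obtain ⟨e0, e1, e2⟩ := alongOrbit_mul_apply σ₁ σ₂ ω θ (rotation (g σ₁ σ₂ ω θ)) j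
      have hc := (hg θ).cos
      have hs := (hg θ).sin
      have h0 := hasDerivAt_const θ (0 : ℝ)
      have h1 := hasDerivAt_const θ (1 : ℝ)
      fin_cases i
      · refine HasDerivAt.congr_deriv (f' := _) ?_ e0.symm
        fin_cases j
        · simpa [rotation, mul_comm] using hc
        · simpa [rotation, mul_comm] using hs.fun_neg
        · simpa [rotation] using h0
      · refine HasDerivAt.congr_deriv (f' := _) ?_ e1.symm
        fin_cases j
        · simpa [rotation, mul_comm] using hs
        · simpa [rotation, mul_comm] using hc
        · simpa [rotation] using h0
      · refine HasDerivAt.congr_deriv (f' := _) ?_ e2.symm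
        fin_cases j
        · simpa [rotation] using h0
        · simpa [rotation] using h0
        · simpa [rotation] using h1
    · ext i j
      fin_cases i <;> fin_cases j <;> simp [rotation, g_zero]

theorem complexQuasiperiodic_exp_of_rotation {G : ℝ → ℝ}
    (hq : MatrixQuasiperiodic (fun θ => rotation (G θ))) :
    ComplexQuasiperiodic (fun θ => Complex.exp (Complex.I * (G θ : ℂ))) := by
  obtain ⟨k, ν, h⟩ := hq
  refine ⟨k, ν, ?_, ?_⟩
  · have e : (fun θ => (Complex.exp (Complex.I * (G θ : ℂ))).re) = fun θ => rotation (G θ) 0 0 := by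
      ext θ
      rw [mul_comm, Complex.exp_ofReal_mul_I_re]
      simp [rotation]
    rw [e]
    exact h 0 0
  · have e : (fun θ => (Complex.exp (Complex.I * (G θ : ℂ))).im) = fun θ => rotation (G θ) 1 0 := by
      ext θ
      rw [mul_comm, Complex.exp_ofReal_mul_I_im]
      simp [rotation]
    rw [e]
    exact h 1 0

end MoserSiegel

end SpinOrbit

theorem proposition8p1 :
    (∃ ω : ℝ, Irrational ω ∧ ∃ σ₁ σ₂ : ℝ, 1 < σ₁ ∧
      ¬ ∃ C : ℝ, ∀ θ : ℝ, |SpinOrbit.MoserSiegel.g σ₁ σ₂ ω θ| ≤ C) ∧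
    ∀ ω σ₁ σ₂ : ℝ, Irrational ω → 1 < σ₁ →
      SpinOrbit.HasMean (SpinOrbit.MoserSiegel.f σ₁ σ₂ ω)
        (SpinOrbit.mean (SpinOrbit.MoserSiegel.f σ₁ σ₂ ω)) ∧
      (∃! Φ : ℝ → Matrix (Fin 3) (Fin 3) ℝ, SpinOrbit.IsPrincipalSolutionMatrix
        (SpinOrbit.alongOrbit (SpinOrbit.MoserSiegel.spinMatrix σ₁ σ₂) ω 0) Φ) ∧
      ((¬ ∃ C : ℝ, ∀ θ : ℝ, |SpinOrbit.MoserSiegel.g σ₁ σ₂ ω θ| ≤ C) →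
        ¬ SpinOrbit.ComplexQuasiperiodic
          (fun θ => Complex.exp (Complex.I * (SpinOrbit.MoserSiegel.g σ₁ σ₂ ω θ : ℂ))) ∧
        ∀ Φ : ℝ → Matrix (Fin 3) (Fin 3) ℝ,
          SpinOrbit.IsPrincipalSolutionMatrix
            (SpinOrbit.alongOrbit (SpinOrbit.MoserSiegel.spinMatrix σ₁ σ₂) ω 0) Φ →
          ¬ SpinOrbit.MatrixQuasiperiodic Φ) := by
  refine ⟨SpinOrbit.MoserSiegel.exists_g_unbounded, fun ω σ₁ σ₂ hω h => ?_⟩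
  have hmean := SpinOrbit.MoserSiegel.hasMean_f h hω σ₂
  have hiff := SpinOrbit.MoserSiegel.isPrincipalSolutionMatrix_iff h hω σ₂
  refine ⟨?_, ⟨_, (hiff _).2 rfl, fun Φ hΦ => (hiff Φ).1 hΦ⟩, fun hunb => ?_⟩
  · rwa [SpinOrbit.MoserSiegel.mean_f h hω]
  have hexp : ¬ SpinOrbit.ComplexQuasiperiodic
      (fun θ => Complex.exp (Complex.I * (SpinOrbit.MoserSiegel.g σ₁ σ₂ ω θ : ℂ))) := fun hq => by
    refine hunb (SpinOrbit.bounded_of_exp_quasiperiodic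
      (SpinOrbit.MoserSiegel.continuous_g h hω σ₂) ?_ hq)
    simp only [SpinOrbit.MoserSiegel.g_eq_integral h hω]
    exact hmean
  refine ⟨hexp, fun Φ hΦ hq => hexp ?_⟩
  rw [(hiff Φ).1 hΦ] at hq
  exact SpinOrbit.MoserSiegel.complexQuasiperiodic_exp_of_rotation hq
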